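/- Consider first-order temporal logic over the time line $\mathbb N$, with predicate symbols of every arity (those of arity $0$ are called propositions; there are countably many symbols of each arity), individual constants, the Boolean connectives, $\forall$, $\exists$ and the temporal operators $\bigcirc$ (next), $\Diamond$ (sometime), $\Box$ (always), until and unless, and without equality and function symbols. Structures have a non-empty domain that is the same at all moments, a rigid interpretation of the constants and an interpretation of the predicate symbols at each moment. A formula is satisfiable if it is true at moment $0$ in some structure under some assignment. A \emph{monodic temporal problem} (in Divided Separated Normal Form) is a quadruple $\mathsf P=\langle \mathcal U,\mathcal I,\mathcal S,\mathcal E\rangle$ of finite sets, where $\mathcal U$ and $\mathcal I$ consist of closed first-order formulae (without temporal operators); $\mathcal S$ consists of step clauses, either ground, $l\to\bigcirc m$ with propositional literals $l,m$, or non-ground, $L(x)\to\bigcirc M(x)$ with unary literals $L,M$, no two different step clauses having the same left-hand side; and $\mathcal E$ consists of eventualities, either ground, $\Diamond l$, or non-ground, $\Diamond L(x)$. Its associated formula is $\mathcal I\land\Box\,\mathcal U\land\Box\,\forall x\,\mathcal S\land\Box\,\forall x\,\mathcal E$ (sets being read as conjunctions); satisfiability and the size $|\mathsf P|$ (number of symbol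 occurrences) of $\mathsf P$ are those of the associated formula. $\mathsf P$ is a \emph{ground eventuality problem} if all its eventualities are ground, and \emph{grounded} if all its eventualities and all its step clauses are ground. The \emph{derived step clauses} of $\mathsf P$ are, for every non-empty set $\{L_1(x)\to\bigcirc M_1(x),\dots,L_k(x)\to\bigcirc M_k(x)\}$ of non-ground step clauses of $\mathsf P$ and every constant $c$ that occurs in $\mathsf P$, $$\forall x\,(L_1(x)\lor\dots\lor L_k(x))\to\bigcirc\,\forall x\,(M_1(x)\lor\dots\lor M_k(x)),$$ $$\exists x\,(L_1(x)\land\dots\land L_k(x))\to\bigcirc\,\exists x\,(M_1(x)\land\dots\land M_k(x)),$$ $$L_j(c)\to\bigcirc\, M_j(c)\qquad(1\le j\le k).$$ Let $\Phi_i\to\bigcirc\Psi_i$ ($0\le i<N$) be a list of all of them, and let $p_0,q_0,p_1,q_1,\dots$ be pairwise distinct propositions that do not occur in $\mathsf P$. (Such propositions exist: for instance, those whose indices follow the largest index of a proposition of $\mathsf P$.) Let $\mathsf P'=\langle\mathcal U',\mathcal I,\mathcal S',\mathcal E\rangle$, where $\mathcal U'=\mathcal U\cup\{p_i\leftrightarrow\Phi_i,\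 q_i\leftrightarrow\Psi_i : 0\le i<N\}$ and $\mathcal S'$ consists of the ground step clauses of $\mathcal S$ and of the clauses $p_i\to\bigcirc q_i$ ($0\le i<N$). \textbf{Theorem (Reducing a Ground Eventuality Problem).} There is a constant $C\in\mathbb N$ such that, for every ground eventuality monodic temporal problem $\mathsf P$ and every such choice of new propositions, $\mathsf P'$ is a grounded monodic temporal problem, $\mathsf P$ is satisfiable if and only if $\mathsf P'$ is satisfiable, and $|\mathsf P'|\le 2^{C|\mathsf P|}$. -/

import Mathlib

universe u

namespace FOTL

/-- Terms: individual variables `x₀, x₁, …` and individual constants `c₀, c₁, …`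
(there are no function symbols). -/
inductive Term where
  | var (x : ℕ)
  | const (c : ℕ)

/-- Formulae of first-order temporal logic, without equality. The predicate symbols of arity `k`
are indexed by `ℕ`; those of arity `0` are the propositions. -/
inductive Formula where
  | tru
  | fls
  | atom (k : ℕ) (p : ℕ) (ts : Fin k → Term)
  | neg (φ : Formula)
  | and (φ ψ : Formula)
  | or (φ ψ : Formula)
  | imp (φ ψ : Formula)
  | iff (φ ψ : Formula)
  | all (x : ℕ) (φ : Formula)
  | ex (x : ℕ) (φ : Formula)
  | next (φ : Formula)
  | sometime (φ : Formula)
  | always (φ : Formula)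
  | until (φ ψ : Formula)
  | unless (φ ψ : Formula)

/-- First-order temporal structures: a non-empty domain that is the same at every moment, a rigid
interpretation of the constants and, for every moment, an interpretation of the predicates. -/
structure TemporalStructure where
  Dom : Type u
  nonempty : Nonempty Dom
  const : ℕ → Dom
  rel : (n : ℕ) → (k : ℕ) → (p : ℕ) → (Fin k → Dom) → Prop

namespace TemporalStructure

/-- Value of a term under an assignment. -/
def val (M : TemporalStructure.{u}) (a : ℕ → M.Dom) : Term → M.Dom
  | .var x => a x
  | .const c => M.const c

/-- `M.Holds φ n a`: the formula `φ` is true in `M` at moment `n` under the assignment `a`. -/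
def Holds (M : TemporalStructure.{u}) : Formula → ℕ → (ℕ → M.Dom) → Prop
  | .tru, _, _ => True
  | .fls, _, _ => False
  | .atom k p ts, n, a => M.rel n k p (fun i => M.val a (ts i))
  | .neg φ, n, a => ¬ M.Holds φ n a
  | .and φ ψ, n, a => M.Holds φ n a ∧ M.Holds ψ n a
  | .or φ ψ, n, a => M.Holds φ n a ∨ M.Holds ψ n a
  | .imp φ ψ, n, a => M.Holds φ n a → M.Holds ψ n a
  | .iff φ ψ, n, a => (M.Holds φ n a ↔ M.Holds ψ n a)
  | .all x φ, n, a => ∀ d : M.Dom, M.Holds φ n (Function.update a x d)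
  | .ex x φ, n, a => ∃ d : M.Dom, M.Holds φ n (Function.update a x d)
  | .next φ, n, a => M.Holds φ (n + 1) a
  | .sometime φ, n, a => ∃ m, n ≤ m ∧ M.Holds φ m a
  | .always φ, n, a => ∀ m, n ≤ m → M.Holds φ m a
  | .until φ ψ, n, a =>
      ∃ m, n ≤ m ∧ M.Holds ψ m a ∧ ∀ i, n ≤ i → i < m → M.Holds φ i a
  | .unless φ ψ, n, a =>
      (∃ m, n ≤ m ∧ M.Holds ψ m a ∧ ∀ i, n ≤ i → i < m → M.Holds φ i a) ∨
        ∀ m, n ≤ m → M.Holds φ m a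

end TemporalStructure

namespace Term

/-- The variables of a term. -/
def vars : Term → Finset ℕ
  | .var x => {x}
  | .const _ => ∅

/-- The constants of a term. -/
def consts : Term → Finset ℕ
  | .var _ => ∅
  | .const c => {c}

end Term

namespace Formula

/-- A formula is satisfiable if it is true at moment `0` in some structure under some
assignment. -/
def Satisfiable (φ : Formula) : Prop :=
  ∃ (M : TemporalStructure.{u}) (a : ℕ → M.Dom), M.Holds φ 0 a

/-- Formulae without temporal operators. -/
def IsFirstOrder : Formula → Prop
  | tru | fls | atom _ _ _ => True
  | neg φ | all _ φ | ex _ φ => φ.IsFirstOrder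
  | and φ ψ | or φ ψ | imp φ ψ | iff φ ψ => φ.IsFirstOrder ∧ ψ.IsFirstOrder
  | next _ | sometime _ | always _ | .until _ _ | .unless _ _ => False

/-- The free variables of a formula. -/
def freeVars : Formula → Finset ℕ
  | tru | fls => ∅
  | atom _ _ ts => Finset.univ.biUnion fun i => (ts i).vars
  | neg φ | next φ | sometime φ | always φ => φ.freeVars
  | and φ ψ | or φ ψ | imp φ ψ | iff φ ψ | .until φ ψ | .unless φ ψ =>
      φ.freeVars ∪ ψ.freeVars
  | all x φ | ex x φ => φ.freeVars.erase x

/-- The constants occurring in a formula. -/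
def consts : Formula → Finset ℕ
  | tru | fls => ∅
  | atom _ _ ts => Finset.univ.biUnion fun i => (ts i).consts
  | neg φ | next φ | sometime φ | always φ | all _ φ | ex _ φ => φ.consts
  | and φ ψ | or φ ψ | imp φ ψ | iff φ ψ | .until φ ψ | .unless φ ψ => φ.consts ∪ ψ.consts

/-- The propositions (null-ary predicate symbols) occurring in a formula. -/
def props : Formula → Finset ℕ
  | tru | fls => ∅
  | atom k p _ => if k = 0 then {p} else ∅
  | neg φ | next φ | sometime φ | always φ | all _ φ | ex _ φ => φ.props
  | and φ ψ | or φ ψ | imp φ ψ | iff φ ψ | .until φ ψ | .unless φ ψ => φ.props ∪ ψ.props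

/-- The size of a formula: the number of occurrences of symbols in it. -/
def size : Formula → ℕ
  | tru | fls => 1
  | atom k _ _ => k + 1
  | neg φ | next φ | sometime φ | always φ => φ.size + 1
  | all _ φ | ex _ φ => φ.size + 2
  | and φ ψ | or φ ψ | imp φ ψ | iff φ ψ | .until φ ψ | .unless φ ψ => φ.size + ψ.size + 1

/-- Conjunction of a list of formulae (`true` if it is empty). -/
def conj : List Formula → Formula
  | [] => tru
  | [φ] => φ
  | φ :: ψ :: l => and φ (conj (ψ :: l))

/-- Disjunction of a list of formulae (`false` if it is empty). -/
def disj : List Formula → Formula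
  | [] => fls
  | [φ] => φ
  | φ :: ψ :: l => or φ (disj (ψ :: l))

/-- The proposition with index `p`. -/
def prop (p : ℕ) : Formula := atom 0 p Fin.elim0

/-- The atom `P(t)` for the unary predicate symbol with index `p`. -/
def unary (p : ℕ) (t : Term) : Formula := atom 1 p fun _ => t

end Formula

/-- Propositional literals: `p` or `¬ p`. -/
structure PropLit where
  positive : Bool
  sym : ℕ

/-- Unary literals: `P(·)` or `¬ P(·)` for a unary predicate symbol `P`. -/
structure UnaryLit where
  positive : Bool
  sym : ℕ

/-- The formula `l`. -/
def PropLit.formula (l : PropLit) : Formula :=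
  if l.positive then .prop l.sym else .neg (.prop l.sym)

/-- The formula `L(t)`. -/
def UnaryLit.app (L : UnaryLit) (t : Term) : Formula :=
  if L.positive then .unary L.sym t else .neg (.unary L.sym t)

/-- The variable `x` that is used in step clauses and eventualities. -/
def x : Term := .var 0

/-- Original temporal step clauses: `l → ○ m` (ground) and `L(x) → ○ M(x)` (non-ground). -/
inductive StepClause where
  | ground (l m : PropLit)
  | nonground (L M : UnaryLit)

/-- Eventuality clauses: `◇ l` (ground) and `◇ L(x)` (non-ground). -/
inductive Eventuality where
  | ground (l : PropLit)
  | nonground (L : UnaryLit)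

namespace StepClause

/-- The left-hand side. -/
def lhs : StepClause → Formula
  | ground l _ => l.formula
  | nonground L _ => L.app x

/-- The right-hand side (without `○`). -/
def rhs : StepClause → Formula
  | ground _ m => m.formula
  | nonground _ M => M.app x

/-- The clause as a formula. -/
def formula (s : StepClause) : Formula := .imp s.lhs (.next s.rhs)

def IsGround : StepClause → Prop
  | ground _ _ => True
  | nonground _ _ => False

/-- `L(x) → ○ M(x)` as the pair `(L, M)`. -/
def nonground? : StepClause → Option (UnaryLit × UnaryLit)
  | ground _ _ => none
  | nonground L M => some (L, M)

/-- `l → ○ m` as the pair `(l, m)`. -/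
def ground? : StepClause → Option (PropLit × PropLit)
  | ground l m => some (l, m)
  | nonground _ _ => none

end StepClause

namespace Eventuality

/-- The clause as a formula. -/
def formula : Eventuality → Formula
  | ground l => .sometime l.formula
  | nonground L => .sometime (L.app x)

def IsGround : Eventuality → Prop
  | ground _ => True
  | nonground _ => False

end Eventuality

/-- The data `⟨U, I, S, E⟩` of a temporal problem; finite sets are given by listing their
elements. -/
structure Problem where
  univ : List Formula
  init : List Formula
  step : List StepClause
  even : List Eventuality

/-- A derived step clause `lhs → ○ rhs`. -/
structure DerivedClause where
  lhs : Formula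
  rhs : Formula

namespace Problem

/-- `P` is a monodic temporal problem in Divided Separated Normal Form: the universal and the
initial part consist of closed first-order formulae, and no two different step clauses have the
same left-hand side. (The shape of step clauses and eventualities is given by their types.) -/
structure IsDSNF (P : Problem) : Prop where
  univ_fo : ∀ φ ∈ P.univ, φ.IsFirstOrder ∧ φ.freeVars = ∅
  init_fo : ∀ φ ∈ P.init, φ.IsFirstOrder ∧ φ.freeVars = ∅
  step_lhs : ∀ s ∈ P.step, ∀ t ∈ P.step, s.lhs = t.lhs → s = t

/-- The associated formula `I ∧ □ U ∧ □ ∀x S ∧ □ ∀x E`. -/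
def formula (P : Problem) : Formula :=
  Formula.conj
    [ Formula.conj P.init,
      .always (Formula.conj P.univ),
      .always (.all 0 (Formula.conj (P.step.map StepClause.formula))),
      .always (.all 0 (Formula.conj (P.even.map Eventuality.formula))) ]

/-- Satisfiability of a problem is satisfiability of the associated formula. -/
def Satisfiable (P : Problem) : Prop := Formula.Satisfiable.{u} P.formula

/-- The size of a problem is the size of the associated formula. -/
def size (P : Problem) : ℕ := P.formula.size

/-- All eventualities are ground. -/
def IsGroundEventuality (P : Problem) : Prop := ∀ e ∈ P.even, e.IsGround

/-- All step clauses and all eventualities are ground. -/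
def IsGrounded (P : Problem) : Prop :=
  (∀ s ∈ P.step, s.IsGround) ∧ ∀ e ∈ P.even, e.IsGround

/-- The original non-ground step clauses. -/
def nongroundSteps (P : Problem) : List (UnaryLit × UnaryLit) :=
  P.step.filterMap StepClause.nonground?

/-- The original ground step clauses. -/
def groundSteps (P : Problem) : List (PropLit × PropLit) :=
  P.step.filterMap StepClause.ground?

/-- `∀x (L₁(x) ∨ … ∨ Lₖ(x)) → ○ ∀x (M₁(x) ∨ … ∨ Mₖ(x))`. -/
def derivedAll (s : List (UnaryLit × UnaryLit)) : DerivedClause where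
  lhs := .all 0 (Formula.disj (s.map fun c => c.1.app x))
  rhs := .all 0 (Formula.disj (s.map fun c => c.2.app x))

/-- `∃x (L₁(x) ∧ … ∧ Lₖ(x)) → ○ ∃x (M₁(x) ∧ … ∧ Mₖ(x))`. -/
def derivedEx (s : List (UnaryLit × UnaryLit)) : DerivedClause where
  lhs := .ex 0 (Formula.conj (s.map fun c => c.1.app x))
  rhs := .ex 0 (Formula.conj (s.map fun c => c.2.app x))

/-- `L(c) → ○ M(c)`. -/
def derivedConst (s : UnaryLit × UnaryLit) (c : ℕ) : DerivedClause where
  lhs := s.1.app (.const c)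
  rhs := s.2.app (.const c)

/-- The non-empty sets of original non-ground step clauses. -/
def premises (P : Problem) : List (List (UnaryLit × UnaryLit)) :=
  P.nongroundSteps.sublists.filter fun s => !s.isEmpty

/-- The constants occurring in the problem. -/
def constList (P : Problem) : List ℕ := P.formula.consts.sort (· ≤ ·)

/-- All derived step clauses. -/
def derived (P : Problem) : List DerivedClause :=
  P.premises.map derivedAll ++ P.premises.map derivedEx ++
    P.nongroundSteps.flatMap fun s => P.constList.map fun c => derivedConst s c

/-- `ν` enumerates pairwise distinct propositions that do not occur in `P`. -/
def IsFreshNaming (P : Problem) (ν : ℕ → ℕ) : Prop :=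
  Function.Injective ν ∧ ∀ i, ν i ∉ P.formula.props

/-- An explicit enumeration of propositions: those after the last one in `P`. -/
def freshNaming (P : Problem) (i : ℕ) : ℕ := P.formula.props.sup id + 1 + i

/-- The definitions `ν (2 i) ↔ Φᵢ` and `ν (2 i + 1) ↔ Ψᵢ` of the new propositions for the sides of
the `i`-th derived step clause `Φᵢ → ○ Ψᵢ`. -/
def namingDefs (P : Problem) (ν : ℕ → ℕ) : List Formula :=
  P.derived.zipIdx.flatMap fun d =>
    [ .iff (.prop (ν (2 * d.2))) d.1.lhs, .iff (.prop (ν (2 * d.2 + 1))) d.1.rhs ]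

/-- The derived step clauses with their sides renamed: `ν (2 i) → ○ ν (2 i + 1)`. -/
def namedSteps (P : Problem) (ν : ℕ → ℕ) : List StepClause :=
  P.derived.zipIdx.map fun d => .ground ⟨true, ν (2 * d.2)⟩ ⟨true, ν (2 * d.2 + 1)⟩

/-- The reduction: the original non-ground step clauses are replaced by all derived step clauses,
whose sides are renamed by propositions; the definitions of these propositions are added to the
universal part. The other parts and the ground step clauses are kept. -/
def groundReduction (P : Problem) (ν : ℕ → ℕ) : Problem where
  univ := P.univ ++ P.namingDefs ν
  init := P.init
  step := (P.groundSteps.map fun c => .ground c.1 c.2) ++ P.namedSteps ν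
  even := P.even

end Problem

end FOTL

/-! Soundness is easy: derived clauses follow from the step clauses, so a model of the problem
becomes one of the reduction once each new proposition is given the truth value of the side it names
(`satisfiable_groundReduction`).

For the converse, take a model of the reduction and relate an element `d` at moment `n` to an
element `e` at moment `n + 1` when passing from `d` to `e` violates no non-ground step clause. The
existential derived clause for the set of clauses whose left-hand side is true of `d` gives `d` a
successor. The universal one for the set of clauses whose right-hand side is false of `e` gives `e`
a predecessor. Hence every element at every moment lies on a run, an infinite sequence of related
elements (`exists_run`); by the constant clauses, staying at a constant of the problem is a run too.
The runs form the domain of a new structure (`ofRuns`). It satisfies the non-ground step clauses by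
construction. At each moment, evaluation maps the runs onto the old domain, and without equality
such a surjection preserves closed first-order formulae (`holds_pullback`), which covers all
remaining parts, the eventualities being ground (`satisfiable_of_groundReduction`).

The size is dominated by the number of sets of step clauses, at most `2 ^ P.size`; each derived
clause has linear size. -/

namespace FOTL

/-! ### Semantics: change of assignment, domain and propositions; runs -/

namespace TemporalStructure

variable {M N : TemporalStructure.{u}}

theorem holds_conj {l : List Formula} {n : ℕ} {a : ℕ → M.Dom} :
    M.Holds (Formula.conj l) n a ↔ ∀ φ ∈ l, M.Holds φ n a := by
  induction l with
  | nil => simp [Formula.conj, Holds]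
  | cons φ l ih => cases l <;> simp_all [Formula.conj, Holds]

theorem holds_disj {l : List Formula} {n : ℕ} {a : ℕ → M.Dom} :
    M.Holds (Formula.disj l) n a ↔ ∃ φ ∈ l, M.Holds φ n a := by
  induction l with
  | nil => simp [Formula.disj, Holds]
  | cons φ l ih => cases l <;> simp_all [Formula.disj, Holds]

theorem val_congr {t : Term} {a b : ℕ → M.Dom} (h : ∀ i ∈ t.vars, a i = b i) :
    M.val a t = M.val b t := by
  cases t with
  | var i => exact h i (by simp [Term.vars])
  | const c => rfl

/-- The truth value of a formula depends only on the values of its free variables. -/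
theorem holds_congr {φ : Formula} {n : ℕ} {a b : ℕ → M.Dom}
    (h : ∀ i ∈ φ.freeVars, a i = b i) : M.Holds φ n a ↔ M.Holds φ n b := by
  have upd : ∀ {φ : Formula} {i : ℕ} {a b : ℕ → M.Dom} (d : M.Dom),
      (∀ j ∈ φ.freeVars.erase i, a j = b j) →
      ∀ j ∈ φ.freeVars, Function.update a i d j = Function.update b i d j := by
    intro φ i a b d h j hj
    by_cases hji : j = i
    · subst hji; simp
    · simp [hji, h j (Finset.mem_erase.2 ⟨hji, hj⟩)]
  induction φ generalizing n a b with
  | tru | fls => exact Iff.rfl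
  | atom k p ts =>
    have : (fun i => M.val a (ts i)) = fun i => M.val b (ts i) := by
      funext i
      exact val_congr fun j hj => h j (Finset.mem_biUnion.2 ⟨i, Finset.mem_univ i, hj⟩)
    simp only [Holds, this]
  | neg φ ih => exact not_congr (ih h)
  | next φ ih => exact ih h
  | sometime φ ih => exact exists_congr fun m => and_congr_right fun _ => ih h
  | always φ ih => exact forall_congr' fun m => imp_congr_right fun _ => ih h
  | all i φ ih => exact forall_congr' fun d => ih (upd d h)
  | ex i φ ih => exact exists_congr fun d => ih (upd d h)
  | _ φ ψ ih₁ ih₂ =>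
    have h₁ := fun n => ih₁ (n := n) fun i hi => h i (Finset.mem_union_left _ hi)
    have h₂ := fun n => ih₂ (n := n) fun i hi => h i (Finset.mem_union_right _ hi)
    simp only [Holds, h₁, h₂]

theorem holds_congr_of_closed {φ : Formula} (h : φ.freeVars = ∅) (n : ℕ) (a b : ℕ → M.Dom) :
    M.Holds φ n a ↔ M.Holds φ n b :=
  holds_congr (by simp [h])

/-- First-order formulae without equality are preserved by pulling back along a surjection. -/
theorem holds_pullback {π : N.Dom → M.Dom} (hπ : Function.Surjective π) {n : ℕ}
    (hrel : ∀ k p ts, N.rel n k p ts ↔ M.rel n k p (π ∘ ts)) {φ : Formula}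
    (hφ : φ.IsFirstOrder) (hc : ∀ c ∈ φ.consts, π (N.const c) = M.const c) (a : ℕ → N.Dom) :
    N.Holds φ n a ↔ M.Holds φ n (π ∘ a) := by
  have upd : ∀ (a : ℕ → N.Dom) (i : ℕ) (d : N.Dom),
      π ∘ Function.update a i d = Function.update (π ∘ a) i (π d) := by
    intro a i d
    funext j
    by_cases hji : j = i
    · subst hji; simp
    · simp [hji]
  induction φ generalizing a with
  | tru | fls => exact Iff.rfl
  | atom k p ts =>
    have : (π ∘ fun i => N.val a (ts i)) = fun i => M.val (π ∘ a) (ts i) := by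
      funext i
      have hi := fun c hc' => hc c (Finset.mem_biUnion.2 ⟨i, Finset.mem_univ i, hc'⟩)
      simp only [Function.comp_apply]
      cases hti : ts i with
      | var j => rfl
      | const c => exact hi c (by simp [hti, Term.consts])
    simp only [Holds, hrel, this]
  | neg φ ih => exact not_congr (ih hφ hc a)
  | all i φ ih =>
    simp only [Holds, ih hφ hc, upd]
    -- Surjectivity matters at the quantifiers only: the images of the elements of `N` exhaust the
    -- domain of `M`.
    exact hπ.forall (p := fun d => M.Holds φ n (Function.update (π ∘ a) i d)) |>.symm
  | ex i φ ih =>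
    simp only [Holds, ih hφ hc, upd]
    exact hπ.exists (p := fun d => M.Holds φ n (Function.update (π ∘ a) i d)) |>.symm
  | and φ ψ ih₁ ih₂ | or φ ψ ih₁ ih₂ | imp φ ψ ih₁ ih₂ | iff φ ψ ih₁ ih₂ =>
    have h₁ := ih₁ hφ.1 (fun c hc' => hc c (Finset.mem_union_left _ hc')) a
    have h₂ := ih₂ hφ.2 (fun c hc' => hc c (Finset.mem_union_right _ hc')) a
    simp only [Holds, h₁, h₂]
  | _ => exact hφ.elim

/-- The structure `M` with the propositions in `S` reinterpreted by `v`. -/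
def withProps (M : TemporalStructure.{u}) (S : Set ℕ) (v : ℕ → ℕ → Prop) :
    TemporalStructure.{u} where
  Dom := M.Dom
  nonempty := M.nonempty
  const := M.const
  rel n k p ts := (k = 0 ∧ p ∈ S ∧ v n p) ∨ (¬ (k = 0 ∧ p ∈ S) ∧ M.rel n k p ts)

theorem holds_withProps {S : Set ℕ} {v : ℕ → ℕ → Prop} {φ : Formula}
    (h : ∀ p ∈ φ.props, p ∉ S) (n : ℕ) (a : ℕ → M.Dom) :
    (M.withProps S v).Holds φ n a ↔ M.Holds φ n a := by
  induction φ generalizing n a with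
  | tru | fls => exact Iff.rfl
  | atom k p ts =>
    have hp : ¬ (k = 0 ∧ p ∈ S) := fun hk => h p (by simp [Formula.props, hk.1]) hk.2
    have hval : ∀ t, (M.withProps S v).val a t = M.val a t := fun t => by cases t <;> rfl
    have hp' : ¬ (k = 0 ∧ p ∈ S ∧ v n p) := fun hk => hp ⟨hk.1, hk.2.1⟩
    simp only [Holds, hval]
    simp only [withProps, hp, hp', false_or, not_false_eq_true, true_and]
  | neg φ ih => exact not_congr (ih h n a)
  | next φ ih => exact ih h _ a
  | sometime φ ih => exact exists_congr fun m => and_congr_right fun _ => ih h m a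
  | always φ ih => exact forall_congr' fun m => imp_congr_right fun _ => ih h m a
  | all i φ ih => exact forall_congr' fun d => ih h n _
  | ex i φ ih => exact exists_congr fun d => ih h n _
  | _ φ ψ ih₁ ih₂ =>
    have h₁ := fun n => ih₁ (fun i hi => h i (Finset.mem_union_left _ hi)) n a
    have h₂ := fun n => ih₂ (fun i hi => h i (Finset.mem_union_right _ hi)) n a
    simp only [Holds, h₁, h₂]

theorem holds_prop {p n : ℕ} {a : ℕ → M.Dom} :
    M.Holds (.prop p) n a ↔ M.rel n 0 p Fin.elim0 := by
  have : (fun i => M.val a (Fin.elim0 i)) = (Fin.elim0 : Fin 0 → M.Dom) := Subsingleton.elim _ _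
  simp only [Formula.prop, Holds, this]

theorem holds_prop_withProps {S : Set ℕ} {v : ℕ → ℕ → Prop} {p : ℕ} (hp : p ∈ S) {n : ℕ}
    {a : ℕ → M.Dom} : (M.withProps S v).Holds (.prop p) n a ↔ v n p := by
  refine holds_prop.trans ?_
  simp [withProps, hp]

/-- The unary literal `L` is true of `d` in `M` at moment `n`. -/
def LitHolds (M : TemporalStructure.{u}) (L : UnaryLit) (n : ℕ) (d : M.Dom) : Prop :=
  if L.positive then M.rel n 1 L.sym fun _ => d else ¬ M.rel n 1 L.sym fun _ => d

theorem holds_app {L : UnaryLit} {t : Term} {n : ℕ} {a : ℕ → M.Dom} :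
    M.Holds (L.app t) n a ↔ M.LitHolds L n (M.val a t) := by
  unfold UnaryLit.app LitHolds
  split <;> rfl

theorem holds_problem {P : Problem} {a : ℕ → M.Dom} :
    M.Holds P.formula 0 a ↔
      (∀ φ ∈ P.init, M.Holds φ 0 a) ∧ (∀ n, ∀ φ ∈ P.univ, M.Holds φ n a) ∧
      (∀ n d, ∀ s ∈ P.step, M.Holds s.lhs n (Function.update a 0 d) →
        M.Holds s.rhs (n + 1) (Function.update a 0 d)) ∧
      ∀ n d, ∀ e ∈ P.even, M.Holds e.formula n (Function.update a 0 d) := by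
  simp [Problem.formula, holds_conj, Holds, StepClause.formula]

/-- From moment `n` on, successors are chosen; before it, predecessors. The induction shifts time by
one: a run for the shifted relation is extended backwards by one predecessor. -/
theorem exists_run {α : Type*} [Nonempty α] {R : ℕ → α → α → Prop}
    (hf : ∀ n d, ∃ e, R n d e) (hb : ∀ n e, ∃ d, R n d e) (n : ℕ) (d : α) :
    ∃ r : ℕ → α, r n = d ∧ ∀ m, R m (r m) (r (m + 1)) := by
  induction n generalizing R with
  | zero =>
    choose f hf using hf
    exact ⟨fun n => Nat.rec d (fun n e => f n e) n, rfl, fun m => hf m _⟩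
  | succ n ih =>
    obtain ⟨r, hr, hR⟩ := ih (R := fun m => R (m + 1)) (fun m => hf _) (fun m => hb _)
    obtain ⟨e, he⟩ := hb 0 (r 0)
    exact ⟨fun m => Nat.casesOn m e r, hr, fun m => by cases m <;> [exact he; exact hR _]⟩

/-- The structure whose elements are the runs in `D`; at moment `n` a run behaves like its
`n`-th element. -/
def ofRuns (M : TemporalStructure.{u}) (D : Set (ℕ → M.Dom)) (hD : D.Nonempty) (c : ℕ → D) :
    TemporalStructure.{u} where
  Dom := D
  nonempty := hD.to_subtype
  const := c
  rel n k p ts := M.rel n k p fun i => (ts i).1 n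

end TemporalStructure

/-! ### Membership in the components of the reduction -/

namespace Problem

open TemporalStructure

variable {P : Problem} {ν : ℕ → ℕ}

theorem mem_nongroundSteps {c : UnaryLit × UnaryLit} :
    c ∈ P.nongroundSteps ↔ StepClause.nonground c.1 c.2 ∈ P.step := by
  simp only [nongroundSteps, List.mem_filterMap]
  constructor
  · rintro ⟨s, hs, h⟩
    cases s <;> simp_all [StepClause.nonground?]
    subst h; exact hs
  · exact fun h => ⟨_, h, rfl⟩

theorem mem_groundSteps {c : PropLit × PropLit} :
    c ∈ P.groundSteps ↔ StepClause.ground c.1 c.2 ∈ P.step := by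
  simp only [groundSteps, List.mem_filterMap]
  constructor
  · rintro ⟨s, hs, h⟩
    cases s <;> simp_all [StepClause.ground?]
    subst h; exact hs
  · exact fun h => ⟨_, h, rfl⟩

theorem mem_derived {d : DerivedClause} :
    d ∈ P.derived ↔ (∃ s ∈ P.premises, derivedAll s = d) ∨ (∃ s ∈ P.premises, derivedEx s = d) ∨
      ∃ s ∈ P.nongroundSteps, ∃ c ∈ P.formula.consts, derivedConst s c = d := by
  simp [derived, constList]

/-- Supplies the premise sets picked out by truth values in a model. Premise sets must be non-empty,
whence the case distinctions where this is applied. -/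
theorem filter_mem_premises {q : UnaryLit × UnaryLit → Bool}
    (h : ∃ c ∈ P.nongroundSteps, q c) : P.nongroundSteps.filter q ∈ P.premises := by
  simpa [premises] using h

theorem subset_of_mem_premises {s : List (UnaryLit × UnaryLit)} (h : s ∈ P.premises) :
    ∀ c ∈ s, c ∈ P.nongroundSteps := by
  simp only [premises, List.mem_filter, List.mem_sublists] at h
  exact fun c hc => h.1.subset hc

theorem mem_namingDefs {φ : Formula} :
    φ ∈ P.namingDefs ν ↔ ∃ i d, P.derived[i]? = some d ∧
      (φ = .iff (.prop (ν (2 * i))) d.lhs ∨ φ = .iff (.prop (ν (2 * i + 1))) d.rhs) := by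
  simp only [namingDefs, List.mem_flatMap, Prod.exists, List.mem_zipIdx_iff_getElem?]
  simp only [List.mem_cons, List.not_mem_nil, or_false]
  exact exists_comm

theorem mem_namedSteps {s : StepClause} :
    s ∈ P.namedSteps ν ↔ ∃ i d, P.derived[i]? = some d ∧
      s = .ground ⟨true, ν (2 * i)⟩ ⟨true, ν (2 * i + 1)⟩ := by
  simp only [namedSteps, List.mem_map, Prod.exists, List.mem_zipIdx_iff_getElem?]
  rw [exists_comm]
  simp only [eq_comm]

theorem mem_step_groundReduction {s : StepClause} :
    s ∈ (P.groundReduction ν).step ↔ (s ∈ P.step ∧ s.IsGround) ∨ s ∈ P.namedSteps ν := by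
  simp only [groundReduction, List.mem_append, List.mem_map, mem_groundSteps]
  refine or_congr_left ⟨?_, ?_⟩
  · rintro ⟨c, hc, rfl⟩; exact ⟨hc, trivial⟩
  · rintro ⟨hs, hg⟩
    cases s with
    | ground l m => exact ⟨(l, m), hs, rfl⟩
    | nonground => exact hg.elim

end Problem

/-! ### Syntax: free variables, constants and propositions -/

namespace Formula

theorem isFirstOrder_conj {l : List Formula} (h : ∀ φ ∈ l, φ.IsFirstOrder) :
    (conj l).IsFirstOrder := by
  induction l with
  | nil => trivial
  | cons φ l ih => cases l <;> simp_all [conj, IsFirstOrder]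

theorem isFirstOrder_disj {l : List Formula} (h : ∀ φ ∈ l, φ.IsFirstOrder) :
    (disj l).IsFirstOrder := by
  induction l with
  | nil => trivial
  | cons φ l ih => cases l <;> simp_all [disj, IsFirstOrder]

theorem freeVars_conj {l : List Formula} {S : Finset ℕ} (h : ∀ φ ∈ l, φ.freeVars ⊆ S) :
    (conj l).freeVars ⊆ S := by
  induction l with
  | nil => simp [conj, freeVars]
  | cons φ l ih => cases l <;> simp_all [conj, freeVars, Finset.union_subset_iff]

theorem freeVars_disj {l : List Formula} {S : Finset ℕ} (h : ∀ φ ∈ l, φ.freeVars ⊆ S) :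
    (disj l).freeVars ⊆ S := by
  induction l with
  | nil => simp [disj, freeVars]
  | cons φ l ih => cases l <;> simp_all [disj, freeVars, Finset.union_subset_iff]

theorem mem_props_conj {l : List Formula} {p : ℕ} :
    p ∈ (conj l).props ↔ ∃ φ ∈ l, p ∈ φ.props := by
  induction l with
  | nil => simp [conj, props]
  | cons φ l ih => cases l <;> simp_all [conj, props]

theorem mem_props_disj {l : List Formula} {p : ℕ} :
    p ∈ (disj l).props ↔ ∃ φ ∈ l, p ∈ φ.props := by
  induction l with
  | nil => simp [disj, props]
  | cons φ l ih => cases l <;> simp_all [disj, props]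

theorem mem_consts_conj {l : List Formula} {p : ℕ} :
    p ∈ (conj l).consts ↔ ∃ φ ∈ l, p ∈ φ.consts := by
  induction l with
  | nil => simp [conj, consts]
  | cons φ l ih => cases l <;> simp_all [conj, consts]

theorem freeVars_prop (p : ℕ) : (prop p).freeVars = ∅ := by simp [prop, freeVars]

theorem isFirstOrder_app (L : UnaryLit) (t : Term) : (L.app t).IsFirstOrder := by
  unfold UnaryLit.app
  split <;> trivial

theorem freeVars_app (L : UnaryLit) (t : Term) : (L.app t).freeVars = t.vars := by
  unfold UnaryLit.app
  split <;> simp [unary, freeVars]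

theorem props_app (L : UnaryLit) (t : Term) : (L.app t).props = ∅ := by
  unfold UnaryLit.app
  split <;> simp [unary, props]

theorem isFirstOrder_propLit (l : PropLit) : l.formula.IsFirstOrder := by
  unfold PropLit.formula
  split <;> trivial

theorem freeVars_propLit (l : PropLit) : l.formula.freeVars = ∅ := by
  unfold PropLit.formula
  split <;> simp [prop, freeVars]

theorem consts_propLit (l : PropLit) : l.formula.consts = ∅ := by
  unfold PropLit.formula
  split <;> simp [prop, consts]

theorem props_propLit (l : PropLit) : l.formula.props = {l.sym} := by
  unfold PropLit.formula
  split <;> simp [prop, props]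

end Formula

/-! ### The reduction is a grounded problem -/

namespace Problem

open TemporalStructure

variable {P : Problem} {ν : ℕ → ℕ}

/-- The sides of derived step clauses are closed first-order formulae without propositions. -/
theorem derived_closed {d : DerivedClause} (hd : d ∈ P.derived) :
    (d.lhs.IsFirstOrder ∧ d.lhs.freeVars = ∅ ∧ d.lhs.props = ∅) ∧
      d.rhs.IsFirstOrder ∧ d.rhs.freeVars = ∅ ∧ d.rhs.props = ∅ := by
  have hall : ∀ (s : List (UnaryLit × UnaryLit)) (f : UnaryLit × UnaryLit → UnaryLit),
      (Formula.all 0 (Formula.disj (s.map fun c => (f c).app x))).IsFirstOrder ∧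
      (Formula.all 0 (Formula.disj (s.map fun c => (f c).app x))).freeVars = ∅ ∧
      (Formula.all 0 (Formula.disj (s.map fun c => (f c).app x))).props = ∅ := by
    intro s f
    refine ⟨Formula.isFirstOrder_disj ?_, ?_, ?_⟩
    · exact List.forall_mem_map.2 fun c _ => Formula.isFirstOrder_app _ _
    · have : (Formula.disj (s.map fun c => (f c).app x)).freeVars ⊆ {0} :=
        Formula.freeVars_disj (List.forall_mem_map.2 fun c _ => (Formula.freeVars_app _ _).subset)
      exact Finset.subset_empty.1 ((Finset.erase_subset_erase 0 this).trans (by simp))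
    · ext p
      simp [Formula.props, Formula.mem_props_disj, Formula.props_app]
  have hex : ∀ (s : List (UnaryLit × UnaryLit)) (f : UnaryLit × UnaryLit → UnaryLit),
      (Formula.ex 0 (Formula.conj (s.map fun c => (f c).app x))).IsFirstOrder ∧
      (Formula.ex 0 (Formula.conj (s.map fun c => (f c).app x))).freeVars = ∅ ∧
      (Formula.ex 0 (Formula.conj (s.map fun c => (f c).app x))).props = ∅ := by
    intro s f
    refine ⟨Formula.isFirstOrder_conj ?_, ?_, ?_⟩
    · exact List.forall_mem_map.2 fun c _ => Formula.isFirstOrder_app _ _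
    · have : (Formula.conj (s.map fun c => (f c).app x)).freeVars ⊆ {0} :=
        Formula.freeVars_conj (List.forall_mem_map.2 fun c _ => (Formula.freeVars_app _ _).subset)
      exact Finset.subset_empty.1 ((Finset.erase_subset_erase 0 this).trans (by simp))
    · ext p
      simp [Formula.props, Formula.mem_props_conj, Formula.props_app]
  obtain ⟨s, -, rfl⟩ | ⟨s, -, rfl⟩ | ⟨s, -, c, -, rfl⟩ := mem_derived.1 hd
  · exact ⟨hall s Prod.fst, hall s Prod.snd⟩
  · exact ⟨hex s Prod.fst, hex s Prod.snd⟩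
  · simp [derivedConst, Formula.isFirstOrder_app, Formula.freeVars_app, Formula.props_app,
      Term.vars]

theorem isFreshNaming_freshNaming (P : Problem) : P.IsFreshNaming P.freshNaming := by
  refine ⟨fun i j h => ?_, fun i hi => ?_⟩
  · simpa [freshNaming] using h
  · have := Finset.le_sup (f := id) hi
    simp only [freshNaming, id] at this
    omega

theorem mem_consts_of_mem_init {φ : Formula} (hφ : φ ∈ P.init) {c : ℕ} (hc : c ∈ φ.consts) :
    c ∈ P.formula.consts :=
  Formula.mem_consts_conj.2 ⟨_, by simp, Formula.mem_consts_conj.2 ⟨φ, hφ, hc⟩⟩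

theorem mem_consts_of_mem_univ {φ : Formula} (hφ : φ ∈ P.univ) {c : ℕ} (hc : c ∈ φ.consts) :
    c ∈ P.formula.consts :=
  Formula.mem_consts_conj.2 ⟨.always (Formula.conj P.univ), by simp,
    Formula.mem_consts_conj.2 ⟨φ, hφ, hc⟩⟩

theorem mem_props_of_mem_step {s : StepClause} (hs : s ∈ P.step) {p : ℕ}
    (hp : p ∈ s.lhs.props) : p ∈ P.formula.props :=
  Formula.mem_props_conj.2
    ⟨.always (.all 0 (Formula.conj (P.step.map StepClause.formula))), by simp,
      Formula.mem_props_conj.2 ⟨s.formula, List.mem_map_of_mem hs, Finset.mem_union_left _ hp⟩⟩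

theorem isDSNF_groundReduction (hP : P.IsDSNF) (hν : P.IsFreshNaming ν) :
    (P.groundReduction ν).IsDSNF where
  init_fo := hP.init_fo
  univ_fo φ hφ := by
    rcases List.mem_append.1 hφ with h | h
    · exact hP.univ_fo φ h
    · obtain ⟨i, d, hd, h⟩ := mem_namingDefs.1 h
      obtain ⟨⟨h₁, h₂, -⟩, h₃, h₄, -⟩ := derived_closed (List.mem_of_getElem? hd)
      rcases h with rfl | rfl
      · exact ⟨⟨trivial, h₁⟩, by simp [Formula.freeVars, Formula.freeVars_prop, h₂]⟩
      · exact ⟨⟨trivial, h₃⟩, by simp [Formula.freeVars, Formula.freeVars_prop, h₄]⟩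
  step_lhs := by
    -- Old and new left-hand sides differ because the new ones contain a fresh proposition.
    have key : ∀ s ∈ P.step, ∀ t ∈ P.namedSteps ν, s.lhs ≠ t.lhs := by
      intro s hs t ht h
      obtain ⟨i, d, -, rfl⟩ := mem_namedSteps.1 ht
      refine hν.2 (2 * i) (mem_props_of_mem_step hs ?_)
      rw [h]
      simp [StepClause.lhs, Formula.props_propLit]
    intro s hs t ht h
    rcases mem_step_groundReduction.1 hs with hs | hs <;>
      rcases mem_step_groundReduction.1 ht with ht | ht
    · exact hP.step_lhs s hs.1 t ht.1 h
    · exact (key s hs.1 t ht h).elim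
    · exact (key t ht.1 s hs h.symm).elim
    · obtain ⟨i, d, -, rfl⟩ := mem_namedSteps.1 hs
      obtain ⟨j, d', -, rfl⟩ := mem_namedSteps.1 ht
      have h := congrArg Formula.props h
      simp only [StepClause.lhs, Formula.props_propLit, Finset.singleton_inj] at h
      have : i = j := by have := hν.1 h; omega
      rw [this]

theorem isGrounded_groundReduction (hE : P.IsGroundEventuality) :
    (P.groundReduction ν).IsGrounded := by
  refine ⟨fun s hs => ?_, hE⟩
  rcases mem_step_groundReduction.1 hs with h | h
  · exact h.2
  · obtain ⟨i, d, -, rfl⟩ := mem_namedSteps.1 h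
    trivial

/-! ### Equisatisfiability -/

/-- Derived step clauses follow from the step clauses. -/
theorem holds_derived {M : TemporalStructure.{u}} {n : ℕ}
    (h : ∀ c ∈ P.nongroundSteps, ∀ d, M.LitHolds c.1 n d → M.LitHolds c.2 (n + 1) d)
    {d : DerivedClause} (hd : d ∈ P.derived) {a : ℕ → M.Dom} (hl : M.Holds d.lhs n a) :
    M.Holds d.rhs (n + 1) a := by
  obtain ⟨s, hs, rfl⟩ | ⟨s, hs, rfl⟩ | ⟨s, hs, c, -, rfl⟩ := mem_derived.1 hd
  · intro e
    have := hl e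
    simp only [holds_disj, List.mem_map, exists_exists_and_eq_and, holds_app] at this ⊢
    obtain ⟨c, hc, hce⟩ := this
    exact ⟨c, hc, h c (subset_of_mem_premises hs c hc) _ hce⟩
  · obtain ⟨e, he⟩ := hl
    refine ⟨e, ?_⟩
    simp only [holds_conj, List.forall_mem_map, holds_app] at he ⊢
    exact fun c hc => h c (subset_of_mem_premises hs c hc) _ (he c hc)
  · exact holds_app.2 (h s hs _ (holds_app.1 hl))

theorem satisfiable_groundReduction (hν : P.IsFreshNaming ν) (hP : Satisfiable.{u} P) :
    Satisfiable.{u} (P.groundReduction ν) := by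
  obtain ⟨M, a, hM⟩ := hP
  -- A new proposition copies the truth value of the side it names. This is unambiguous: `ν` is
  -- injective, and even and odd positions separate left from right sides.
  let v : ℕ → ℕ → Prop := fun n p => ∃ i d, P.derived[i]? = some d ∧
    (p = ν (2 * i) ∧ M.Holds d.lhs n a ∨ p = ν (2 * i + 1) ∧ M.Holds d.rhs n a)
  have hv₁ : ∀ n i d, P.derived[i]? = some d → (v n (ν (2 * i)) ↔ M.Holds d.lhs n a) := by
    intro n i d hd
    refine ⟨?_, fun h => ⟨i, d, hd, .inl ⟨rfl, h⟩⟩⟩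
    rintro ⟨j, e, he, ⟨h, h'⟩ | ⟨h, h'⟩⟩
    · obtain rfl : i = j := by have := hν.1 h; omega
      rw [hd] at he
      cases he
      exact h'
    · have := hν.1 h; omega
  have hv₂ : ∀ n i d, P.derived[i]? = some d → (v n (ν (2 * i + 1)) ↔ M.Holds d.rhs n a) := by
    intro n i d hd
    refine ⟨?_, fun h => ⟨i, d, hd, .inr ⟨rfl, h⟩⟩⟩
    rintro ⟨j, e, he, ⟨h, h'⟩ | ⟨h, h'⟩⟩
    · have := hν.1 h; omega
    · obtain rfl : i = j := by have := hν.1 h; omega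
      rw [hd] at he
      cases he
      exact h'
  have hder : ∀ n, ∀ d ∈ P.derived, M.Holds d.lhs n a → M.Holds d.rhs (n + 1) a := by
    intro n d hd
    refine holds_derived (fun c hc d hcd => ?_) hd
    have := (holds_problem.1 hM).2.2.1 n d _ (mem_nongroundSteps.1 hc)
    simp only [StepClause.lhs, StepClause.rhs, holds_app, x, val, Function.update_self] at this
    exact this hcd
  refine ⟨M.withProps (Set.range ν) v, a, ?_⟩
  obtain ⟨hI, hU, hS, hE⟩ := holds_problem.1
    ((holds_withProps (v := v) (S := Set.range ν)
      (by rintro p hp ⟨i, rfl⟩; exact hν.2 i hp) 0 a).2 hM)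
  refine holds_problem.2 ⟨hI, fun n φ hφ => ?_, fun n d s hs => ?_, hE⟩
  · rcases List.mem_append.1 hφ with h | h
    · exact hU n φ h
    · obtain ⟨i, d, hd, h⟩ := mem_namingDefs.1 h
      obtain ⟨⟨-, -, h₁⟩, -, -, h₂⟩ := derived_closed (List.mem_of_getElem? hd)
      rcases h with rfl | rfl
      · exact (holds_prop_withProps (Set.mem_range_self _)).trans
          ((hv₁ n i d hd).trans (holds_withProps (by simp [h₁]) n a).symm)
      · exact (holds_prop_withProps (Set.mem_range_self _)).trans
          ((hv₂ n i d hd).trans (holds_withProps (by simp [h₂]) n a).symm)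
  · rcases mem_step_groundReduction.1 hs with h | h
    · exact hS n d s h.1
    · obtain ⟨i, e, he, rfl⟩ := mem_namedSteps.1 h
      intro h
      refine (holds_prop_withProps (Set.mem_range_self _)).2 ((hv₂ _ i e he).2 ?_)
      exact hder n e (List.mem_of_getElem? he)
        ((hv₁ _ i e he).1 ((holds_prop_withProps (Set.mem_range_self _)).1 h))

/-- In a model of the reduction, the derived step clauses are true. -/
theorem holds_derived_of_groundReduction {M : TemporalStructure.{u}} {a : ℕ → M.Dom}
    (hM : M.Holds (P.groundReduction ν).formula 0 a) {d : DerivedClause} (hd : d ∈ P.derived)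
    {n : ℕ} (hl : M.Holds d.lhs n a) : M.Holds d.rhs (n + 1) a := by
  obtain ⟨-, hU, hS, -⟩ := holds_problem.1 hM
  obtain ⟨i, hi⟩ := List.mem_iff_getElem?.1 hd
  have h₁ := hU n _ (List.mem_append_right _ (mem_namingDefs.2 ⟨i, d, hi, .inl rfl⟩))
  have h₂ := hU (n + 1) _ (List.mem_append_right _ (mem_namingDefs.2 ⟨i, d, hi, .inr rfl⟩))
  have h₃ := hS n (a 0) _ (mem_step_groundReduction.2 (.inr (mem_namedSteps.2 ⟨i, d, hi, rfl⟩)))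
  -- The quantified variable was instantiated by `a 0`, so the assignment is unchanged.
  rw [Function.update_eq_self] at h₃
  exact h₂.1 (h₃ (h₁.2 hl))

theorem satisfiable_of_groundReduction (hP : P.IsDSNF) (hE : P.IsGroundEventuality)
    (hP' : Satisfiable.{u} (P.groundReduction ν)) : Satisfiable.{u} P := by
  classical
  obtain ⟨M, a, hM⟩ := hP'
  have hder := @holds_derived_of_groundReduction P ν M a hM
  have := M.nonempty
  let R : ℕ → M.Dom → M.Dom → Prop := fun n d e =>
    ∀ c ∈ P.nongroundSteps, M.LitHolds c.1 n d → M.LitHolds c.2 (n + 1) e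
  have hf : ∀ n d, ∃ e, R n d e := by
    intro n d
    -- The existential clause for all clauses whose left-hand side is true of `d`; `d` itself
    -- witnesses its premise. If there are none, any successor will do.
    by_cases h : ∃ c ∈ P.nongroundSteps, decide (M.LitHolds c.1 n d)
    · obtain ⟨e, he⟩ := @hder _ (mem_derived.2 (.inr (.inl ⟨_, filter_mem_premises h, rfl⟩))) n
        ⟨d, by
          simp only [holds_conj, List.forall_mem_map, holds_app, List.mem_filter]
          intro c hc
          simpa [x, val] using hc.2⟩
      refine ⟨e, fun c hc hcd => ?_⟩
      simp only [holds_conj, List.forall_mem_map, holds_app, List.mem_filter] at he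
      simpa [x, val] using he c ⟨hc, by simpa using hcd⟩
    · exact ⟨d, fun c hc hcd => (h ⟨c, hc, by simpa using hcd⟩).elim⟩
  have hb : ∀ n e, ∃ d, R n d e := by
    intro n e
    -- The universal clause for all clauses whose right-hand side is false of `e`. If no `d`
    -- preceded `e`, each `d` would satisfy one of their left-hand sides, so one of the right-hand
    -- sides would be true of `e`.
    by_cases h : ∃ c ∈ P.nongroundSteps, decide (¬ M.LitHolds c.2 (n + 1) e)
    · by_contra! hR
      have := @hder _ (mem_derived.2 (.inl ⟨_, filter_mem_premises h, rfl⟩)) n (by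
        intro d
        obtain ⟨c, hc, hcd, hce⟩ : ∃ c ∈ P.nongroundSteps, M.LitHolds c.1 n d ∧
            ¬ M.LitHolds c.2 (n + 1) e := by simpa [R] using hR d
        simp only [holds_disj, List.mem_map, exists_exists_and_eq_and, holds_app, List.mem_filter]
        exact ⟨c, ⟨hc, by simpa using hce⟩, by simpa [x, val] using hcd⟩) e
      simp only [holds_disj, List.mem_map, exists_exists_and_eq_and, holds_app,
        List.mem_filter] at this
      obtain ⟨c, ⟨-, hc⟩, hce⟩ := this
      exact of_decide_eq_true hc (by simpa [x, val] using hce)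
    · exact ⟨e, fun c hc _ => by_contra fun hce => h ⟨c, hc, by simpa using hce⟩⟩
  let D : Set (ℕ → M.Dom) := {r | ∀ n, R n (r n) (r (n + 1))}
  have hrun : ∀ n d, ∃ r : D, r.1 n = d := fun n d =>
    let ⟨r, hr, hR⟩ := exists_run hf hb n d
    ⟨⟨r, hR⟩, hr⟩
  obtain ⟨r₀, -⟩ := hrun 0 (a 0)
  -- Only constants of the problem have derived clauses making the constant sequence a run; the
  -- others may denote any run.
  have hconst : ∀ c, ∃ r : D, c ∈ P.formula.consts → ∀ n, r.1 n = M.const c := by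
    intro c
    by_cases hc : c ∈ P.formula.consts
    · refine ⟨⟨fun _ => M.const c, fun n s hs hcs => ?_⟩, fun _ _ => rfl⟩
      exact holds_app.1 (@hder _ (mem_derived.2 (.inr (.inr ⟨s, hs, c, hc, rfl⟩))) n
        (holds_app.2 hcs))
    · exact ⟨r₀, fun h => (hc h).elim⟩
  choose κ hκ using hconst
  let N := M.ofRuns D ⟨_, r₀.2⟩ κ
  have hN : ∀ (φ : Formula), φ.IsFirstOrder → φ.freeVars = ∅ →
      (∀ c ∈ φ.consts, c ∈ P.formula.consts) → ∀ n b, N.Holds φ n b ↔ M.Holds φ n a := by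
    intro φ hφ hφ' hc n b
    refine (holds_pullback (M := M) (N := N) (π := fun r : D => r.1 n) (hrun n)
      (fun _ _ _ => Iff.rfl) hφ (fun c h => hκ c (hc c h) n) b).trans ?_
    exact holds_congr_of_closed hφ' _ _ _
  have hlit : ∀ (l : PropLit) n b b', N.Holds l.formula n b ↔ M.Holds l.formula n b' :=
    fun l n b b' => (hN _ (Formula.isFirstOrder_propLit l) (Formula.freeVars_propLit l)
      (by simp [Formula.consts_propLit]) n b).trans
      (holds_congr_of_closed (Formula.freeVars_propLit l) _ _ _)
  obtain ⟨hI, hU, hS, hE'⟩ := holds_problem.1 hM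
  refine ⟨N, fun _ => r₀, holds_problem.2 ⟨fun φ hφ => ?_, fun n φ hφ => ?_,
    fun n r s hs => ?_, fun n r e he => ?_⟩⟩
  · exact (hN φ (hP.init_fo φ hφ).1 (hP.init_fo φ hφ).2
      (fun c => mem_consts_of_mem_init hφ) _ _).2 (hI φ hφ)
  · exact (hN φ (hP.univ_fo φ hφ).1 (hP.univ_fo φ hφ).2
      (fun c => mem_consts_of_mem_univ hφ) _ _).2 (hU n φ (List.mem_append_left _ hφ))
  · cases s with
    | ground l m =>
      intro h
      exact (hlit m _ _ _).2 (hS n (a 0) _ (mem_step_groundReduction.2 (.inl ⟨hs, trivial⟩))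
        ((hlit l _ _ _).1 h))
    | nonground L K =>
      have hr : ∀ n (b : ℕ → N.Dom) L, N.Holds (UnaryLit.app L x) n (Function.update b 0 r) ↔
          M.LitHolds L n (r.1 n) := by
        intro n b L
        rw [holds_app]
        simp only [x, val, Function.update_self]
        exact Iff.rfl
      intro h
      exact (hr _ _ _).2 (r.2 n (L, K) (mem_nongroundSteps.2 hs) ((hr _ _ _).1 h))
  · cases e with
    | ground l =>
      obtain ⟨m, hm, h⟩ := hE' n (a 0) _ he
      exact ⟨m, hm, (hlit l _ _ _).2 h⟩
    -- Groundness is essential here: `◇ L(x)` for fixed elements of `M` says nothing about runs that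
    -- move between them.
    | nonground L => exact (hE _ he).elim

end Problem

/-! ### Size bounds -/

namespace Formula

/-- Charging each member one connective makes the weight additive over lists; the final `+ 1` is
needed for the empty conjunction. -/
theorem size_conj_le (l : List Formula) :
    (conj l).size ≤ (l.map fun φ => φ.size + 1).sum + 1 := by
  induction l with
  | nil => simp [conj, size]
  | cons φ l ih =>
    cases l
    · simp [conj]; omega
    · simp only [conj, size, List.map_cons, List.sum_cons] at ih ⊢; omega

theorem size_disj_le (l : List Formula) :
    (disj l).size ≤ (l.map fun φ => φ.size + 1).sum + 1 := by
  induction l with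
  | nil => simp [disj, size]
  | cons φ l ih =>
    cases l
    · simp [disj]; omega
    · simp only [disj, size, List.map_cons, List.sum_cons] at ih ⊢; omega

theorem sum_size_le_size_conj (l : List Formula) :
    (l.map fun φ => φ.size + 1).sum ≤ (conj l).size + 1 := by
  induction l with
  | nil => simp
  | cons φ l ih =>
    cases l
    · simp [conj]
    · simp only [conj, size, List.map_cons, List.sum_cons] at ih ⊢; omega

theorem card_consts_le_size (φ : Formula) : φ.consts.card ≤ φ.size := by
  induction φ with
  | tru | fls => simp [consts]
  | atom k p ts =>
    have h : ∀ t : Term, t.consts.card ≤ 1 := fun t => by cases t <;> simp [Term.consts]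
    have := Finset.card_biUnion_le_card_mul Finset.univ (fun i => (ts i).consts) 1
      fun i _ => h (ts i)
    simp only [consts, size, Finset.card_univ, Fintype.card_fin] at this ⊢
    omega
  | neg φ ih | next φ ih | sometime φ ih | always φ ih | all i φ ih | ex i φ ih =>
    simp only [consts, size]; omega
  | _ φ ψ ih₁ ih₂ =>
    have := Finset.card_union_le φ.consts ψ.consts
    simp only [consts, size]; omega

theorem size_app_le (L : UnaryLit) (t : Term) : (L.app t).size ≤ 3 := by
  unfold UnaryLit.app
  split <;> simp [unary, size]

end Formula

theorem sum_map_filterMap_le {α β : Type*} {l : List α} {g : α → Option β} {f : β → ℕ} {h : α → ℕ}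
    (hfh : ∀ a b, g a = some b → f b ≤ h a) : ((l.filterMap g).map f).sum ≤ (l.map h).sum := by
  induction l with
  | nil => simp
  | cons a l ih =>
    cases hg : g a with
    | none => simp only [List.filterMap_cons_none hg, List.map_cons, List.sum_cons]; omega
    | some b =>
      have := hfh a b hg
      simp only [List.filterMap_cons_some hg, List.map_cons, List.sum_cons]; omega

namespace Problem

variable {P : Problem} {ν : ℕ → ℕ}

/-- The 10 counts three conjunctions, three `□` and two quantifiers of two symbols each. -/
theorem size_eq (P : Problem) :
    P.size = (Formula.conj P.init).size + (Formula.conj P.univ).size +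
      (Formula.conj (P.step.map StepClause.formula)).size +
      (Formula.conj (P.even.map Eventuality.formula)).size + 10 := by
  simp only [size, formula, Formula.conj, Formula.size]
  omega

theorem sum_step_le_size (P : Problem) :
    (P.step.map fun s => s.formula.size + 1).sum ≤ P.size := by
  have := Formula.sum_size_le_size_conj (P.step.map StepClause.formula)
  rw [List.map_map] at this
  have h := size_eq P
  simp only [Function.comp_def] at this
  omega

theorem sum_nongroundSteps_le_size (P : Problem) :
    (P.nongroundSteps.map fun c => (c.1.app x).size + 1 + ((c.2.app x).size + 1)).sum ≤
      P.size := by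
  refine (sum_map_filterMap_le fun s c h => ?_).trans (sum_step_le_size P)
  cases s with
  | ground => simp [StepClause.nonground?] at h
  | nonground L M =>
    cases h
    simp only [StepClause.formula, StepClause.lhs, StepClause.rhs, Formula.size]
    omega

theorem length_nongroundSteps_le_size (P : Problem) : P.nongroundSteps.length ≤ P.size := by
  refine le_trans ?_ (sum_nongroundSteps_le_size P)
  have := List.length_le_sum_of_one_le (P.nongroundSteps.map fun c =>
    (c.1.app x).size + 1 + ((c.2.app x).size + 1)) (by
      simp only [List.forall_mem_map]; intros; omega)
  simpa using this

/-- A side uses each premise at most once; the 3 covers a quantifier and the empty-list slack, or a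
whole literal at a constant. -/
theorem size_derived_le {d : DerivedClause} (hd : d ∈ P.derived) :
    d.lhs.size ≤ P.size + 3 ∧ d.rhs.size ≤ P.size + 3 := by
  have key : ∀ s ∈ P.premises, ∀ f : UnaryLit × UnaryLit → UnaryLit,
      (∀ c, f c = c.1 ∨ f c = c.2) →
      ((s.map fun c => (f c).app x).map fun φ => φ.size + 1).sum ≤ P.size := by
    intro s hs f hf
    simp only [premises, List.mem_filter, List.mem_sublists] at hs
    rw [List.map_map]
    refine ((hs.1.map _).sum_le_sum (by simp)).trans
      ((List.sum_le_sum fun c _ => ?_).trans (sum_nongroundSteps_le_size P))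
    simp only [Function.comp_apply]
    rcases hf c with h | h <;> rw [h] <;> omega
  obtain ⟨s, hs, rfl⟩ | ⟨s, hs, rfl⟩ | ⟨s, -, c, -, rfl⟩ := mem_derived.1 hd
  · have h₁ := key s hs Prod.fst fun _ => .inl rfl
    have h₂ := key s hs Prod.snd fun _ => .inr rfl
    have h₃ := Formula.size_disj_le (s.map fun c => c.1.app x)
    have h₄ := Formula.size_disj_le (s.map fun c => c.2.app x)
    simp only [derivedAll, Formula.size]
    omega
  · have h₁ := key s hs Prod.fst fun _ => .inl rfl
    have h₂ := key s hs Prod.snd fun _ => .inr rfl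
    have h₃ := Formula.size_conj_le (s.map fun c => c.1.app x)
    have h₄ := Formula.size_conj_le (s.map fun c => c.2.app x)
    simp only [derivedEx, Formula.size]
    omega
  · have h₁ := Formula.size_app_le s.1 (.const c)
    have h₂ := Formula.size_app_le s.2 (.const c)
    simp only [derivedConst]
    omega

theorem length_derived_le (P : Problem) :
    P.derived.length ≤ 2 * 2 ^ P.size + P.size * P.size := by
  have h₁ : P.premises.length ≤ 2 ^ P.size :=
    (List.length_filter_le _ _).trans (by
      rw [List.length_sublists]
      exact Nat.pow_le_pow_right two_pos (length_nongroundSteps_le_size P))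
  have h₂ : P.nongroundSteps.length * P.formula.consts.card ≤ P.size * P.size :=
    Nat.mul_le_mul (length_nongroundSteps_le_size P) (Formula.card_consts_le_size P.formula)
  simp only [derived, constList, List.length_append, List.length_map, List.length_flatMap,
    List.map_const', List.sum_replicate, Finset.length_sort, smul_eq_mul]
  omega

theorem sum_namingDefs_le (P : Problem) (ν : ℕ → ℕ) :
    ((P.namingDefs ν).map fun φ => φ.size + 1).sum ≤ P.derived.length * 2 * (P.size + 6) := by
  have hlen : (P.namingDefs ν).length = P.derived.length * 2 := by
    simp [namingDefs, List.length_flatMap]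
  have := List.sum_le_card_nsmul ((P.namingDefs ν).map fun φ => φ.size + 1) (P.size + 6) (by
    simp only [List.forall_mem_map]
    intro φ hφ
    obtain ⟨i, d, hd, h⟩ := mem_namingDefs.1 hφ
    have := size_derived_le (List.mem_of_getElem? hd)
    rcases h with rfl | rfl <;> simp only [Formula.size, Formula.prop] <;> omega)
  simpa [hlen] using this

theorem sum_namedSteps_le (P : Problem) (ν : ℕ → ℕ) :
    ((P.namedSteps ν).map fun s => s.formula.size + 1).sum ≤ P.derived.length * 5 := by
  have hlen : (P.namedSteps ν).length = P.derived.length := by simp [namedSteps]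
  have := List.sum_le_card_nsmul ((P.namedSteps ν).map fun s => s.formula.size + 1) 5 (by
    simp only [List.forall_mem_map]
    intro s hs
    obtain ⟨i, d, -, rfl⟩ := mem_namedSteps.1 hs
    simp [StepClause.formula, StepClause.lhs, StepClause.rhs, PropLit.formula, Formula.size,
      Formula.prop])
  simpa [hlen] using this

theorem sum_groundSteps_le (P : Problem) :
    ((P.groundSteps.map fun c => StepClause.ground c.1 c.2).map
      fun s => s.formula.size + 1).sum ≤ (P.step.map fun s => s.formula.size + 1).sum := by
  rw [List.map_map]
  refine sum_map_filterMap_le fun s c h => ?_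
  cases s with
  | ground => cases h; exact le_rfl
  | nonground => simp [StepClause.ground?] at h

/-- Each derived clause costs two definitions of weight at most `P.size + 6` and one step clause of
weight 5. The 4 is slack from passing between conjunctions and sums, for the universal and the step
part. -/
theorem size_groundReduction_le_add (P : Problem) (ν : ℕ → ℕ) :
    (P.groundReduction ν).size ≤ P.size + P.derived.length * (2 * P.size + 17) + 4 := by
  have h₁ := Formula.size_conj_le (P.univ ++ P.namingDefs ν)
  have h₂ := Formula.size_conj_le ((P.groundReduction ν).step.map StepClause.formula)
  have h₃ := sum_namingDefs_le P ν
  have h₄ := sum_namedSteps_le P ν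
  have h₅ := sum_groundSteps_le P
  have h₆ := Formula.sum_size_le_size_conj P.univ
  have h₇ := Formula.sum_size_le_size_conj (P.step.map StepClause.formula)
  have h₈ : P.derived.length * (2 * P.size + 17) =
      P.derived.length * 2 * (P.size + 6) + P.derived.length * 5 := by ring
  rw [List.map_append, List.sum_append] at h₁
  rw [List.map_map, Function.comp_def] at h₂ h₇
  simp only [groundReduction, List.map_append, List.sum_append] at h₂
  simp only [size_eq, groundReduction, List.map_append] at h₃ h₈ ⊢
  omega

theorem size_groundReduction_le (P : Problem) (ν : ℕ → ℕ) :
    (P.groundReduction ν).size ≤ 2 ^ (10 * P.size) := by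
  have h₁ := size_groundReduction_le_add P ν
  have h₂ := length_derived_le P
  -- With `t = 2 ^ P.size ≥ 1024`, the bound is at most `11 * t ^ 3 ≤ t ^ 4`; the exponent 10 is
  -- generous.
  have h₃ : P.size < 2 ^ P.size := Nat.lt_two_pow_self
  have h₄ : 10 ≤ P.size := by rw [size_eq]; omega
  have h₅ : 2 ^ 10 ≤ 2 ^ P.size := Nat.pow_le_pow_right two_pos h₄
  rw [mul_comm, pow_mul]
  generalize 2 ^ P.size = t at *
  have h₆ : P.derived.length ≤ 3 * t ^ 2 := by nlinarith
  have h₇ : P.derived.length * (2 * P.size + 17) ≤ 3 * t ^ 2 * (3 * t) :=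
    Nat.mul_le_mul h₆ (by omega)
  calc _ ≤ t ^ 3 + 9 * t ^ 3 + t ^ 3 := by
        have : t ≤ t ^ 3 := Nat.le_self_pow (by norm_num) t
        nlinarith
    _ ≤ t * t ^ 3 := by nlinarith [pow_pos (show 0 < t by omega) 3]
    _ = t ^ 4 := by ring
    _ ≤ t ^ 10 := Nat.pow_le_pow_right (by omega) (by norm_num)

end Problem

end FOTL

theorem mainTheorem8 :
    ∃ C : ℕ, ∀ P : FOTL.Problem, P.IsDSNF → P.IsGroundEventuality →
      P.IsFreshNaming P.freshNaming ∧
      ∀ ν : ℕ → ℕ, P.IsFreshNaming ν →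
        (P.groundReduction ν).IsDSNF ∧
        (P.groundReduction ν).IsGrounded ∧
        (FOTL.Problem.Satisfiable.{u} P ↔
          FOTL.Problem.Satisfiable.{u} (P.groundReduction ν)) ∧
        (P.groundReduction ν).size ≤ 2 ^ (C * P.size) :=
  ⟨10, fun P hP hE => ⟨P.isFreshNaming_freshNaming, fun ν hν =>
    ⟨FOTL.Problem.isDSNF_groundReduction hP hν, FOTL.Problem.isGrounded_groundReduction hE,
      ⟨FOTL.Problem.satisfiable_groundReduction hν,
        FOTL.Problem.satisfiable_of_groundReduction hP hE⟩,
      P.size_groundReduction_le ν⟩⟩⟩
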